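/- **Setting.** Fix a set $X\subseteq[0,\infty)$ of possible amounts with $0,1\in X$ (for example $X=\{0,1\}$ or $X=[0,\infty)$), and for every number $n$ of agents two values $0<l_n<h_n$ (otherwise arbitrary). A downward-closed environment with $n$ agents is a set $\mathcal F\subseteq X^n$ of feasible allocations such that decreasing one coordinate of a feasible allocation, within $X$, yields a feasible allocation. An algorithm is a function $\mathcal A:\{l_n,h_n\}^n\to\mathcal F$; its welfare at $v$ is $\sum_i v_i\,\mathcal A(v)_i$; it is monotone if, whenever agent $i$ raises its value $v_i$ and the other values stay fixed, $\mathcal A(v)_i$ does not decrease. A transformation $\mathcal T$ is a randomized, adaptive procedure that on input $v\in\{l_n,h_n\}^n$ may query $\mathcal A$ at valuation vectors, and ask whether given allocations belong to $\mathcal F$, and returns an allocation $\mathcal T(\mathcal A)(v)$; otherwise it knows only $n$, $l_n$, $h_n$, $X$, and that $\mathcal F$ is downward-closed. Its running time is the number of its steps, each query and each internal computation step counting as one (a single step may compute arbitrarily much from the answers received so far). It runs in polynomial time if its running time, and hence the number of its queries to $\mathcal A$ and $\mathcal F$, is at most a fixed polynomial in $n$, for all $\mathcal F$, $\mathcal A$,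 $v$ and all outcomes of its random choices that have positive probability. **Theorem.** (1) There is no polynomial-time transformation $\mathcal T$ such that, for every $n$, every downward-closed environment $\mathcal F$ and every algorithm $\mathcal A$: with probability one, $\mathcal T(\mathcal A)(v)\in\mathcal F$ and $\mathcal T(\mathcal A)$ has at least the welfare of $\mathcal A$ at every input $v$; and $\mathcal T(\mathcal A)$ is monotone, even if only in expectation (that is, $\mathbb E[\mathcal T(\mathcal A)(v)_i]$ does not decrease when agent $i$ raises its value). (2) Moreover, for every polynomial-time transformation $\mathcal T$, every $c\in\mathbb N$ and all sufficiently large $n$, there are a downward-closed environment $\mathcal F$ with $n$ agents and an algorithm $\mathcal A$ such that, with $\omega$ the random choices of $\mathcal T$, the probability over $\omega$ that $\mathcal T_\omega(\mathcal A)$ is a feasible, monotone allocation rule with at least the welfare of $\mathcal A$ at every input is at most $n^{-c}$. -/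

import Mathlib

open Filter

namespace BlackBox

/-- An allocation: the amount of stuff given to each of the `n` agents. -/
abbrev Alloc (n : ℕ) : Type := Fin n → ℝ

/-- A valuation vector of `n` agents whose values lie in the set `V`. -/
abbrev Profile (V : Set ℝ) (n : ℕ) : Type := Fin n → V

/-- An allocation rule for valuations in `V`. -/
abbrev Rule (V : Set ℝ) (n : ℕ) : Type := Profile V n → Alloc n

/-- The welfare `v ⬝ x` of the allocation `x` at the valuation vector `v`. -/
def welfare {V : Set ℝ} {n : ℕ} (v : Profile V n) (x : Alloc n) : ℝ :=
  ∑ i, (v i : ℝ) * x i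

/-- `F` is a downward-closed feasibility set, when the amounts that an agent can be given are
the elements of `X` (for example `X = {0, 1}` or `X = [0, ∞)`): decreasing the amount given to
one agent of a feasible allocation yields a feasible allocation. -/
structure DownwardClosed (X : Set ℝ) {n : ℕ} (F : Set (Alloc n)) : Prop where
  amount_mem : ∀ x ∈ F, ∀ i, x i ∈ X
  decrease : ∀ x ∈ F, ∀ i, ∀ a ∈ X, a ≤ x i → Function.update x i a ∈ F

/-- The allocation rule `A` is an algorithm for the feasibility set `F`. -/
def IsAlgorithm {V : Set ℝ} {n : ℕ} (F : Set (Alloc n)) (A : Rule V n) : Prop :=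
  ∀ v, A v ∈ F

/-- `v'` arises from `v` by agent `i` increasing its declared value. -/
def Raises {V : Set ℝ} {n : ℕ} (i : Fin n) (v v' : Profile V n) : Prop :=
  (∀ j, j ≠ i → v' j = v j) ∧ (v i : ℝ) ≤ v' i

/-- A monotone allocation rule. -/
def MonotoneRule {V : Set ℝ} {n : ℕ} (A : Rule V n) : Prop :=
  ∀ (i : Fin n) (v v' : Profile V n), Raises i v v' → A v i ≤ A v' i

/-- The rule `B` has at least the welfare of the rule `A` at every input. -/
def PreservesWelfare {V : Set ℝ} {n : ℕ} (A B : Rule V n) : Prop :=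
  ∀ v, welfare v (A v) ≤ welfare v (B v)

/-- An adaptive computation with black-box access to an algorithm and to membership in a
feasibility set. It halts with an output, or makes one step of internal computation, or queries
the algorithm at a valuation vector and continues depending on the allocation returned, or asks
whether an allocation is feasible and continues depending on the answer.
There is no restriction on what a single step may compute from the answers received so far, so
that the computations of every concrete machine model with these two oracles are of this form,
with one constructor for each step of the machine. -/
inductive Program (V : Set ℝ) (n : ℕ) : Type
  | output (x : Alloc n) : Program V n
  | compute (next : Program V n) : Program V n
  | askAlgorithm (w : Profile V n) (next : Alloc n → Program V n) : Program V n
  | askFeasible (y : Alloc n) (next : Bool → Program V n) : Program V n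

open Classical in
/-- The output of a computation with access to the feasibility set `F` and the algorithm `A`. -/
noncomputable def Program.run {V : Set ℝ} {n : ℕ} (F : Set (Alloc n)) (A : Rule V n) :
    Program V n → Alloc n
  | .output x => x
  | .compute next => next.run F A
  | .askAlgorithm w next => (next (A w)).run F A
  | .askFeasible y next => (next (decide (y ∈ F))).run F A

open Classical in
/-- The running time of a computation with access to `F` and `A`: the number of its steps, each
query being one step. In particular it bounds the number of queries. -/
noncomputable def Program.time {V : Set ℝ} {n : ℕ} (F : Set (Alloc n)) (A : Rule V n) :
    Program V n → ℕ
  | .output _ => 1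
  | .compute next => next.time F A + 1
  | .askAlgorithm w next => (next (A w)).time F A + 1
  | .askFeasible y next => (next (decide (y ∈ F))).time F A + 1

/-- A randomized adaptive black-box transformation, for instances with `n` agents and valuations
in `V n`: a random seed `ω` is drawn, and then, on input `v`, the computation `prog n ω v` is
carried out. A deterministic transformation is one with a single seed. As the seed space is
arbitrary, the random choices at different inputs may be independent or correlated. -/
structure Transformation (V : ℕ → Set ℝ) where
  Seed : ℕ → Type
  law : ∀ n, PMF (Seed n)
  prog : ∀ n, Seed n → Profile (V n) n → Program (V n) n

namespace Transformation

variable {V : ℕ → Set ℝ}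

/-- The allocation rule `T(A)` for the seed `ω`. -/
noncomputable def apply (T : Transformation V) {n : ℕ} (F : Set (Alloc n)) (A : Rule (V n) n)
    (ω : T.Seed n) : Rule (V n) n :=
  fun v => (T.prog n ω v).run F A

/-- The expected amount that `T(A)` gives to agent `i` at input `v` (amounts are nonnegative). -/
noncomputable def expectedAmount (T : Transformation V) {n : ℕ} (F : Set (Alloc n))
    (A : Rule (V n) n) (v : Profile (V n) n) (i : Fin n) : ENNReal :=
  ∑' ω, T.law n ω * ENNReal.ofReal (T.apply F A ω v i)

/-- `T` runs in polynomial time: the running time is at most a fixed polynomial in the number of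
agents, whatever the downward-closed environment, the algorithm, the input and the seed. -/
def PolynomialTime (X : Set ℝ) (T : Transformation V) : Prop :=
  ∃ p : Polynomial ℕ, ∀ (n : ℕ) (F : Set (Alloc n)) (A : Rule (V n) n),
    DownwardClosed X F → IsAlgorithm F A → ∀ ω ∈ (T.law n).support, ∀ v,
      (T.prog n ω v).time F A ≤ p.eval n

/-- With probability one, `T(A)` returns feasible allocations, for every algorithm `A`. -/
def Feasible (X : Set ℝ) (T : Transformation V) : Prop :=
  ∀ (n : ℕ) (F : Set (Alloc n)) (A : Rule (V n) n),
    DownwardClosed X F → IsAlgorithm F A → ∀ ω ∈ (T.law n).support,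
      IsAlgorithm F (T.apply F A ω)

/-- `T(A)` is monotone in expectation, for every algorithm `A`. -/
def Monotone (X : Set ℝ) (T : Transformation V) : Prop :=
  ∀ (n : ℕ) (F : Set (Alloc n)) (A : Rule (V n) n),
    DownwardClosed X F → IsAlgorithm F A →
      ∀ (i : Fin n) (v v' : Profile (V n) n), Raises i v v' →
        T.expectedAmount F A v i ≤ T.expectedAmount F A v' i

/-- With probability one, `T(A)` preserves the welfare of `A` at every input, for every
algorithm `A`. -/
def WelfarePreserving (X : Set ℝ) (T : Transformation V) : Prop :=
  ∀ (n : ℕ) (F : Set (Alloc n)) (A : Rule (V n) n),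
    DownwardClosed X F → IsAlgorithm F A → ∀ ω ∈ (T.law n).support,
      PreservesWelfare A (T.apply F A ω)

/-- The seeds for which `T(A)` is a feasible and monotone allocation rule that preserves the
welfare of `A` at every input. -/
def successSeeds (T : Transformation V) {n : ℕ} (F : Set (Alloc n)) (A : Rule (V n) n) :
    Set (T.Seed n) :=
  {ω | IsAlgorithm F (T.apply F A ω) ∧ MonotoneRule (T.apply F A ω) ∧
    PreservesWelfare A (T.apply F A ω)}

end Transformation

end BlackBox

/-! The secret is a subset `s` of `N = 4 * K` blocks of eight agents. The known allocation serves
the two `.inl` agents of each block. The secret allocation serves three `.inr` agents per block,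
chosen by the bit of `s`, and the agent `.inl false` exactly in the blocks outside `s`. The
algorithm returns the secret allocation only at `input e l h s`, where it is strictly better, and
the known one elsewhere.

Compare the input `∅` with the input `s`, reached by raising the agents `.inl false` of the blocks
in `s` one at a time. A feasible output with at least the known welfare is either the known
allocation, which gives such an agent 1, or lies below the secret one, which gives it 0. So a
monotone rule that starts with the known allocation keeps it all the way to `s`, where its welfare
is too small. Hence the secret must already be used at `∅` (`mem_discoveries_of_monotoneRule`). In
expectation, the amount of the raised agent is the probability of the known output, so the same path
shows that this probability vanishes at `∅` (`support_subset_discoveringSeeds`).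

At `∅` the secret is hard to find. A query to the algorithm detects at most one secret. All sets of
fewer than `N` agents are feasible anyway, so a feasibility query is informative only if it touches
at least `N` agents of the secret set. These meet at least `K` blocks and fix `K` bits of `s`, so
each query detects at most a fraction `2 ^ (-K)` of the secrets
(`card_filter_mem_secretEnvironment_le`). Averaging over `s` yields a secret used with probability
at most `t / 2 ^ K` in time `t`, with `K = n / 32`. -/

namespace BlackBox

open Finset

/-! ### Unit allocations and the environments they generate -/

section Allocations

variable {n : ℕ}

open Classical in
/-- The allocation giving one unit to each agent of `S`. -/
noncomputable def unitAlloc (S : Finset (Fin n)) : Alloc n := fun i => if i ∈ S then 1 else 0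

/-- The allocations with amounts in `X` that give at most one unit to each agent of some member
of `𝒮`, and nothing to the others. -/
def environment (X : Set ℝ) (𝒮 : Set (Finset (Fin n))) : Set (Alloc n) :=
  {x | (∀ i, x i ∈ X) ∧ ∃ S ∈ 𝒮, x ≤ unitAlloc S}

theorem environment_mono {X : Set ℝ} {𝒮 𝒯 : Set (Finset (Fin n))} (h : 𝒮 ⊆ 𝒯) :
    environment X 𝒮 ⊆ environment X 𝒯 := fun _ hx =>
  ⟨hx.1, hx.2.imp fun _ hS => ⟨h hS.1, hS.2⟩⟩

theorem downwardClosed_environment (X : Set ℝ) (𝒮 : Set (Finset (Fin n))) :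
    DownwardClosed X (environment X 𝒮) where
  amount_mem x hx := hx.1
  decrease := by
    rintro x ⟨hx, S, hS, hxS⟩ i a ha hai
    refine ⟨fun j => ?_, S, hS, fun j => ?_⟩
    · by_cases hj : j = i
      · subst hj; simpa using ha
      · simpa [hj] using hx j
    · by_cases hj : j = i
      · subst hj; simpa using hai.trans (hxS j)
      · simpa [hj] using hxS j

theorem unitAlloc_mem_environment {X : Set ℝ} (hX0 : 0 ∈ X) (hX1 : 1 ∈ X)
    {𝒮 : Set (Finset (Fin n))} {S : Finset (Fin n)} (hS : S ∈ 𝒮) :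
    unitAlloc S ∈ environment X 𝒮 := by
  refine ⟨fun i => ?_, S, hS, le_rfl⟩
  unfold unitAlloc
  split_ifs <;> assumption

theorem welfare_unitAlloc {V : Set ℝ} (v : Profile V n) (S : Finset (Fin n)) :
    welfare v (unitAlloc S) = ∑ i ∈ S, (v i : ℝ) := by
  classical
  simp [welfare, unitAlloc, Finset.sum_ite_mem]

theorem welfare_mono {V : Set ℝ} (hV : ∀ a ∈ V, 0 ≤ a) (v : Profile V n) {x y : Alloc n}
    (hxy : x ≤ y) : welfare v x ≤ welfare v y :=
  Finset.sum_le_sum fun i _ => mul_le_mul_of_nonneg_left (hxy i) (hV _ (v i).2)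

theorem eq_of_le_of_welfare_le {V : Set ℝ} (hV : ∀ a ∈ V, 0 < a) {v : Profile V n}
    {x y : Alloc n} (hxy : x ≤ y) (h : welfare v y ≤ welfare v x) : x = y := by
  by_contra hne
  obtain ⟨i, hi⟩ := Function.ne_iff.mp hne
  refine absurd h (not_le.mpr (Finset.sum_lt_sum
    (fun i _ => mul_le_mul_of_nonneg_left (hxy i) (hV _ (v i).2).le) ⟨i, mem_univ i, ?_⟩))
  exact mul_lt_mul_of_pos_left (lt_of_le_of_ne (hxy i) hi) (hV _ (v i).2)

end Allocations

/-! ### The block construction: welfare comparisons and counting of secrets -/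

section Construction

variable {N n : ℕ}

/-- The positions of the agents in one block. -/
abbrev Slot : Type := Bool ⊕ Bool × Fin 3

/-- The agents served by the commonly known allocation. -/
def knownSet (e : Fin N × Slot ↪ Fin n) : Finset (Fin n) :=
  (univ.filter fun p : Fin N × Slot => p.2.isLeft).map e

/-- The agents served by the allocation with secret `s`. -/
def secretSet (e : Fin N × Slot ↪ Fin n) (s : Finset (Fin N)) : Finset (Fin n) :=
  (univ.filter fun p : Fin N × Slot =>
    (p.2 = .inl false ∧ p.1 ∉ s) ∨ ∃ k, p.2 = .inr (decide (p.1 ∈ s), k)).map e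

open Classical in
/-- The input at which exactly the agents `e (j, .inl false)` with `j ∉ K` have the low value. -/
noncomputable def input (e : Fin N × Slot ↪ Fin n) (l h : ℝ) (K : Finset (Fin N)) :
    Profile ({l, h} : Set ℝ) n :=
  fun i => if ∃ j ∉ K, i = e (j, .inl false) then ⟨l, by simp⟩ else ⟨h, by simp⟩

variable (e : Fin N × Slot ↪ Fin n) {l h : ℝ}

theorem coe_input_inl_false (K : Finset (Fin N)) (j : Fin N) :
    (input e l h K (e (j, .inl false)) : ℝ) = if j ∈ K then h else l := by
  by_cases hj : j ∈ K <;> simp [input, hj]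

theorem coe_input_inl_true (K : Finset (Fin N)) (j : Fin N) :
    (input e l h K (e (j, .inl true)) : ℝ) = h := by
  simp [input]

theorem coe_input_inr (K : Finset (Fin N)) (j : Fin N) (t : Bool × Fin 3) :
    (input e l h K (e (j, .inr t)) : ℝ) = h := by
  simp [input]

theorem input_injective (hlh : l < h) : Function.Injective (input e l h) := by
  intro K L hKL
  ext j
  have := congrArg (fun v => (v (e (j, .inl false)) : ℝ)) hKL
  simp only [coe_input_inl_false] at this
  split_ifs at this <;> simp_all

theorem raises_input (hlh : l < h) {K : Finset (Fin N)} (j : Fin N) :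
    Raises (e (j, .inl false)) (input e l h K) (input e l h (insert j K)) := by
  constructor
  · intro i hi
    have : (∃ j' ∉ insert j K, i = e (j', .inl false)) ↔ ∃ j' ∉ K, i = e (j', .inl false) := by
      constructor
      · rintro ⟨j', hj', rfl⟩
        exact ⟨j', fun h => hj' (mem_insert_of_mem h), rfl⟩
      · rintro ⟨j', hj', rfl⟩
        refine ⟨j', fun h => ?_, rfl⟩
        rcases mem_insert.mp h with rfl | h
        · exact hi rfl
        · exact hj' h
    simp only [input, this]
  · simp only [coe_input_inl_false, mem_insert_self, if_true]
    split_ifs <;> linarith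

theorem welfare_knownSet (K : Finset (Fin N)) :
    welfare (input e l h K) (unitAlloc (knownSet e)) =
      ∑ j, (h + if j ∈ K then h else l) := by
  rw [welfare_unitAlloc, knownSet, Finset.sum_map, Finset.sum_filter, Fintype.sum_prod_type]
  refine Finset.sum_congr rfl fun j _ => ?_
  simp [Fintype.sum_sum_type, coe_input_inl_false, coe_input_inl_true]

theorem le_welfare_knownSet (hl : 0 ≤ l) (hh : 0 ≤ h) (K : Finset (Fin N)) :
    N * h ≤ welfare (input e l h K) (unitAlloc (knownSet e)) := by
  rw [welfare_knownSet]
  calc (N : ℝ) * h = ∑ _j : Fin N, h := by simp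
    _ ≤ _ := Finset.sum_le_sum fun j _ => by split_ifs <;> linarith

theorem welfare_secretSet (s : Finset (Fin N)) :
    welfare (input e l h s) (unitAlloc (secretSet e s)) =
      ∑ j, (3 * h + if j ∈ s then 0 else l) := by
  rw [welfare_unitAlloc, secretSet, Finset.sum_map, Finset.sum_filter, Fintype.sum_prod_type]
  refine Finset.sum_congr rfl fun j _ => ?_
  by_cases hj : j ∈ s <;>
    simp [Fintype.sum_sum_type, Fintype.sum_prod_type, coe_input_inl_false, coe_input_inr, hj,
      add_comm]

/-- Blockwise, `2 * h < 3 * h` inside `s` and `h + l < 3 * h + l` outside. -/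
theorem welfare_knownSet_lt_secretSet (hN : 0 < N) (hh : 0 < h) (s : Finset (Fin N)) :
    welfare (input e l h s) (unitAlloc (knownSet e)) <
      welfare (input e l h s) (unitAlloc (secretSet e s)) := by
  rw [welfare_knownSet, welfare_secretSet]
  have : Nonempty (Fin N) := ⟨⟨0, hN⟩⟩
  exact Finset.sum_lt_sum_of_nonempty univ_nonempty fun j _ => by split_ifs <;> linarith

/-- The agents `.inl true` alone contribute `N * h` to the known welfare. Thus the small sets, added
to hide the secret from feasibility queries, are useless as outputs. -/
theorem welfare_lt_knownSet_of_card_lt (hl : 0 < l) (hlh : l < h) (K : Finset (Fin N))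
    {S : Finset (Fin n)} (hS : S.card < N) {x : Alloc n} (hx : x ≤ unitAlloc S) :
    welfare (input e l h K) x < welfare (input e l h K) (unitAlloc (knownSet e)) := by
  have hV : ∀ a ∈ ({l, h} : Set ℝ), 0 ≤ a := by
    rintro a (rfl | rfl) <;> linarith
  have hV' : ∀ a ∈ ({l, h} : Set ℝ), a ≤ h := by
    rintro a (rfl | rfl) <;> linarith
  calc welfare (input e l h K) x ≤ ∑ i ∈ S, (input e l h K i : ℝ) :=
        (welfare_mono hV _ hx).trans_eq (welfare_unitAlloc _ _)
    _ ≤ ∑ _i ∈ S, h := Finset.sum_le_sum fun i _ => hV' _ (input e l h K i).2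
    _ = S.card * h := by simp
    _ < N * h := mul_lt_mul_of_pos_right (by exact_mod_cast hS) (hl.trans hlh)
    _ ≤ _ := le_welfare_knownSet e hl.le (hl.trans hlh).le K

theorem unitAlloc_secretSet_inl_false {s : Finset (Fin N)} {j : Fin N} (hj : j ∈ s) :
    unitAlloc (secretSet e s) (e (j, .inl false)) = 0 := by
  simp [unitAlloc, secretSet, hj]

theorem unitAlloc_knownSet_inl (j : Fin N) (b : Bool) :
    unitAlloc (knownSet e) (e (j, .inl b)) = 1 := by
  simp [unitAlloc, knownSet]

/-- The feasible allocations that are known in advance. -/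
def knownEnvironment (X : Set ℝ) : Set (Alloc n) :=
  environment X {S | S = knownSet e ∨ S.card < N}

/-- The feasible allocations when the secret is `s`. -/
def secretEnvironment (X : Set ℝ) (s : Finset (Fin N)) : Set (Alloc n) :=
  environment X {S | S = secretSet e s ∨ S = knownSet e ∨ S.card < N}

open Classical in
/-- The algorithm that serves the secret set at a single input. -/
noncomputable def secretRule (l h : ℝ) (s : Finset (Fin N)) : Rule ({l, h} : Set ℝ) n :=
  fun v => if v = input e l h s then unitAlloc (secretSet e s) else unitAlloc (knownSet e)

theorem isAlgorithm_secretRule {X : Set ℝ} (hX0 : 0 ∈ X) (hX1 : 1 ∈ X) (s : Finset (Fin N)) :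
    IsAlgorithm (secretEnvironment e X s) (secretRule e l h s) := by
  intro v
  unfold secretRule
  split_ifs <;> exact unitAlloc_mem_environment hX0 hX1 (by simp)

theorem isAlgorithm_knownSet {X : Set ℝ} (hX0 : 0 ∈ X) (hX1 : 1 ∈ X) :
    IsAlgorithm (V := {l, h}) (knownEnvironment e X) fun _ => unitAlloc (knownSet e) :=
  fun _ => unitAlloc_mem_environment hX0 hX1 (by simp)

theorem welfare_knownSet_le_secretRule (hN : 0 < N) (hh : 0 < h) (s K : Finset (Fin N)) :
    welfare (input e l h K) (unitAlloc (knownSet e)) ≤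
      welfare (input e l h K) (secretRule e l h s (input e l h K)) := by
  unfold secretRule
  split_ifs with hK
  · rw [hK]
    exact (welfare_knownSet_lt_secretSet e hN hh s).le
  · exact le_rfl

theorem eq_knownSet_of_mem_knownEnvironment (hl : 0 < l) (hlh : l < h) {X : Set ℝ}
    {K : Finset (Fin N)} {x : Alloc n} (hx : x ∈ knownEnvironment e X)
    (hw : welfare (input e l h K) (unitAlloc (knownSet e)) ≤ welfare (input e l h K) x) :
    x = unitAlloc (knownSet e) := by
  obtain ⟨-, S, rfl | hS, hxS⟩ := hx
  · refine eq_of_le_of_welfare_le ?_ hxS hw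
    rintro a (rfl | rfl) <;> linarith
  · exact absurd hw (not_le.mpr (welfare_lt_knownSet_of_card_lt e hl hlh K hS hxS))

theorem le_secretSet_of_notMem_knownEnvironment {X : Set ℝ} {s : Finset (Fin N)} {x : Alloc n}
    (hx : x ∈ secretEnvironment e X s) (hx' : x ∉ knownEnvironment e X) :
    x ≤ unitAlloc (secretSet e s) := by
  obtain ⟨hxX, S, rfl | hS, hxS⟩ := hx
  · exact hxS
  · exact absurd ⟨hxX, S, hS, hxS⟩ hx'

theorem amount_eq_zero_of_ne_knownSet (hl : 0 < l) (hlh : l < h) {X : Set ℝ}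
    (hX : ∀ a ∈ X, 0 ≤ a) {s K : Finset (Fin N)} {x : Alloc n}
    (hx : x ∈ secretEnvironment e X s)
    (hw : welfare (input e l h K) (unitAlloc (knownSet e)) ≤ welfare (input e l h K) x)
    (hne : x ≠ unitAlloc (knownSet e)) {j : Fin N} (hj : j ∈ s) :
    x (e (j, .inl false)) = 0 := by
  refine le_antisymm ?_ (hX _ (hx.1 _))
  rw [← unitAlloc_secretSet_inl_false e hj]
  exact le_secretSet_of_notMem_knownEnvironment e hx
    (fun h' => hne (eq_knownSet_of_mem_knownEnvironment e hl hlh h' hw)) _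

/-- The secrets of two secret sets agree on the block of a common agent. -/
theorem mem_iff_of_mem_secretSet {s t : Finset (Fin N)} {p : Fin N × Slot}
    (hs : e p ∈ secretSet e s) (ht : e p ∈ secretSet e t) : p.1 ∈ s ↔ p.1 ∈ t := by
  simp only [secretSet, Finset.mem_map', mem_filter, mem_univ, true_and] at hs ht
  rcases hs with ⟨h1, h2⟩ | ⟨k, h1⟩ <;> rcases ht with ⟨h3, h4⟩ | ⟨k', h3⟩ <;> simp_all

/-- A member of `𝒜` is determined by its part outside `J`. -/
theorem card_filter_agree_le {ι : Type*} [Fintype ι] [DecidableEq ι] (J t : Finset ι)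
    (𝒜 : Finset (Finset ι)) (h : ∀ s ∈ 𝒜, ∀ j ∈ J, j ∈ s ↔ j ∈ t) :
    𝒜.card ≤ 2 ^ (Fintype.card ι - J.card) := by
  rw [← card_compl, ← card_powerset]
  refine Finset.card_le_card_of_injOn (fun s => s \ J) (fun s _ => ?_) ?_
  · simp only [coe_powerset, Set.mem_preimage, Set.mem_powerset_iff, coe_subset]
    intro i hi
    exact mem_compl.mpr (mem_sdiff.mp hi).2
  · intro s hs s' hs' hss
    ext i
    by_cases hi : i ∈ J
    · rw [h s hs i hi, h s' hs' i hi]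
    · simpa [hi] using Finset.ext_iff.mp hss i

/-- A secret set has at most four agents in each block. -/
theorem card_image_fst_ge (P : Finset (Fin N × Slot)) (s : Finset (Fin N))
    (hP : ∀ p ∈ P, e p ∈ secretSet e s) : P.card ≤ 4 * (P.image Prod.fst).card := by
  refine Finset.card_le_mul_card_image P 4 fun j _ => ?_
  calc _ ≤ (univ.filter fun t : Slot =>
        t = .inl false ∨ ∃ k, t = .inr (decide (j ∈ s), k)).card := by
        refine Finset.card_le_card_of_injOn Prod.snd (fun p hp => ?_) ?_
        · simp only [coe_filter, Set.mem_ofPred_eq] at hp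
          have := hP p hp.1
          simp only [secretSet, Finset.mem_map', mem_filter, mem_univ, true_and] at this
          simp only [coe_filter, mem_univ, true_and, Set.mem_ofPred_eq]
          rcases this with h1 | h1
          · exact Or.inl h1.1
          · exact Or.inr (hp.2 ▸ h1)
        · intro p hp q hq hpq
          simp only [coe_filter, Set.mem_ofPred_eq] at hp hq
          exact Prod.ext (hp.2.trans hq.2.symm) hpq
    _ ≤ 4 := by
        generalize decide (j ∈ s) = b
        revert b
        decide

open Classical in
theorem card_filter_subset_secretSet_le {K : ℕ} (hN : N = 4 * K) (Y : Finset (Fin n))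
    (hY : N ≤ Y.card) :
    (univ.filter fun s : Finset (Fin N) => Y ⊆ secretSet e s).card ≤ 2 ^ (N - K) := by
  rcases (univ.filter fun s : Finset (Fin N) => Y ⊆ secretSet e s).eq_empty_or_nonempty with
    h0 | ⟨t, ht⟩
  · simp [h0]
  have htY : Y ⊆ secretSet e t := (mem_filter.mp ht).2
  obtain ⟨P, rfl⟩ : ∃ P : Finset (Fin N × Slot), P.map e = Y := by
    obtain ⟨P, -, hP⟩ := Finset.subset_map_iff.mp htY
    exact ⟨P, hP.symm⟩
  have hP : P.card ≤ 4 * (P.image Prod.fst).card :=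
    card_image_fst_ge e P t fun p hp => htY (mem_map_of_mem e hp)
  rw [card_map] at hY
  refine (card_filter_agree_le (P.image Prod.fst) t _ fun s hs j hj => ?_).trans ?_
  · obtain ⟨p, hp, rfl⟩ := mem_image.mp hj
    exact mem_iff_of_mem_secretSet e ((mem_filter.mp hs).2 (mem_map_of_mem e hp))
      (htY (mem_map_of_mem e hp))
  · rw [Fintype.card_fin]
    exact Nat.pow_le_pow_right two_pos (by omega)

theorem knownEnvironment_subset (X : Set ℝ) (s : Finset (Fin N)) :
    knownEnvironment e X ⊆ secretEnvironment e X s :=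
  environment_mono fun _ h => Or.inr h

open Classical in
theorem card_filter_mem_secretEnvironment_le {K : ℕ} (hN : N = 4 * K) {X : Set ℝ}
    (hX : ∀ a ∈ X, 0 ≤ a) (y : Alloc n) :
    (univ.filter fun s : Finset (Fin N) =>
      y ∈ secretEnvironment e X s ∧ y ∉ knownEnvironment e X).card ≤ 2 ^ (N - K) := by
  rcases (univ.filter fun s : Finset (Fin N) =>
      y ∈ secretEnvironment e X s ∧ y ∉ knownEnvironment e X).eq_empty_or_nonempty with
    h0 | ⟨t, ht⟩
  · simp [h0]
  obtain ⟨-, hyt, hy0⟩ := mem_filter.mp ht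
  have hsub : ∀ s, y ≤ unitAlloc (secretSet e s) →
      (univ.filter fun i => y i ≠ 0) ⊆ secretSet e s := by
    intro s hs i hi
    by_contra hne
    have h1 := hs i
    simp only [unitAlloc, hne, if_false] at h1
    exact (mem_filter.mp hi).2 (le_antisymm h1 (hX _ (hyt.1 i)))
  -- A smaller support would make `y` feasible in advance, as its amounts are at most 1.
  have hcard : N ≤ (univ.filter fun i => y i ≠ 0).card := by
    by_contra! hlt
    refine hy0 ⟨hyt.1, _, Or.inr hlt, fun i => ?_⟩
    have h1 := le_secretSet_of_notMem_knownEnvironment e hyt hy0 i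
    by_cases hi : y i = 0
    · simp [unitAlloc, hi]
    · simp only [unitAlloc, mem_filter, mem_univ, true_and, hi, not_false_iff, ne_eq, if_true]
      refine h1.trans ?_
      unfold unitAlloc
      split_ifs <;> norm_num
  refine (Finset.card_le_card fun s hs => ?_).trans
    (card_filter_subset_secretSet_le e hN _ hcard)
  obtain ⟨-, hys, -⟩ := mem_filter.mp hs
  exact mem_filter.mpr
    ⟨mem_univ _, hsub s (le_secretSet_of_notMem_knownEnvironment e hys hy0)⟩

end Construction

/-! ### Query counting and averaging over secrets -/

section Indistinguishability

open Classical in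
/-- If each query distinguishes at most `M` of the instances `(F s, A s)` from `(F₀, A₀)`, then a
computation of time `t + 1` distinguishes at most `t * M` of them. -/
theorem Program.card_filter_run_ne_add_le {V : Set ℝ} {n : ℕ} {σ : Type*} [Fintype σ]
    (F₀ : Set (Alloc n)) (A₀ : Rule V n) (F : σ → Set (Alloc n)) (A : σ → Rule V n) (M : ℕ)
    (hA : ∀ w, (univ.filter fun s => A s w ≠ A₀ w).card ≤ M)
    (hF : ∀ y, (univ.filter fun s => ¬(y ∈ F s ↔ y ∈ F₀)).card ≤ M) (P : Program V n) :
    (univ.filter fun s => P.run (F s) (A s) ≠ P.run F₀ A₀).card + M ≤ P.time F₀ A₀ * M := by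
  induction P with
  | output x => simp [Program.run, Program.time]
  | compute next ih =>
    exact ih.trans (Nat.mul_le_mul_right M (Nat.le_succ _))
  | askAlgorithm w next ih =>
    have hsub : (univ.filter fun s =>
        (next (A s w)).run (F s) (A s) ≠ (next (A₀ w)).run F₀ A₀) ⊆
        (univ.filter fun s => (next (A₀ w)).run (F s) (A s) ≠ (next (A₀ w)).run F₀ A₀) ∪
          univ.filter fun s => A s w ≠ A₀ w := by
      intro s hs
      simp only [mem_union, mem_filter, mem_univ, true_and] at hs ⊢
      by_cases h : A s w = A₀ w
      · rw [h] at hs; exact Or.inl hs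
      · exact Or.inr h
    have h1 := (card_le_card hsub).trans (card_union_le _ _)
    have h2 := ih (A₀ w)
    have h3 := hA w
    change _ ≤ ((next (A₀ w)).time F₀ A₀ + 1) * M
    rw [add_mul, one_mul]
    exact Nat.add_le_add_right (h1.trans (by omega)) M
  | askFeasible y next ih =>
    have hsub : (univ.filter fun s =>
        (next (decide (y ∈ F s))).run (F s) (A s) ≠ (next (decide (y ∈ F₀))).run F₀ A₀) ⊆
        (univ.filter fun s => (next (decide (y ∈ F₀))).run (F s) (A s) ≠
          (next (decide (y ∈ F₀))).run F₀ A₀) ∪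
          univ.filter fun s => ¬(y ∈ F s ↔ y ∈ F₀) := by
      intro s hs
      simp only [mem_union, mem_filter, mem_univ, true_and] at hs ⊢
      by_cases h : y ∈ F s ↔ y ∈ F₀
      · simp only [h] at hs; exact Or.inl hs
      · exact Or.inr h
    have h1 := (card_le_card hsub).trans (card_union_le _ _)
    have h2 := ih (decide (y ∈ F₀))
    have h3 := hF y
    change _ ≤ ((next (decide (y ∈ F₀))).time F₀ A₀ + 1) * M
    rw [add_mul, one_mul]
    exact Nat.add_le_add_right (h1.trans (by omega)) M

open Classical in
/-- Averaging: if every outcome of `μ` lies in at most `m` of the events `B s`, then some event has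
probability at most `m` divided by the number of events. -/
theorem exists_card_mul_toOuterMeasure_le {Ω σ : Type*} [Fintype σ] [Nonempty σ] (μ : PMF Ω)
    (B : σ → Set Ω) (m : ℕ) (hB : ∀ ω ∈ μ.support, (univ.filter fun s => ω ∈ B s).card ≤ m) :
    ∃ s, (Fintype.card σ : ENNReal) * μ.toOuterMeasure (B s) ≤ m := by
  have hsum : ∑ s, μ.toOuterMeasure (B s) ≤ m := by
    calc ∑ s, μ.toOuterMeasure (B s) = ∑ s, ∑' ω, (B s).indicator μ ω := by
          simp only [PMF.toOuterMeasure_apply]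
      _ = ∑' ω, ∑ s, (B s).indicator μ ω :=
          (Summable.tsum_finsetSum fun _ _ => ENNReal.summable).symm
      _ ≤ ∑' ω, m * μ ω := by
          refine ENNReal.tsum_le_tsum fun ω => ?_
          by_cases hω : μ ω = 0
          · simp [Set.indicator, hω]
          · simp only [Set.indicator, ← Finset.sum_filter, Finset.sum_const, nsmul_eq_mul]
            gcongr
            exact hB ω ((PMF.mem_support_iff _ _).mpr hω)
      _ = m := by rw [ENNReal.tsum_mul_left, PMF.tsum_coe, mul_one]
  obtain ⟨s, -, hs⟩ := Finset.exists_min_image univ (fun s => μ.toOuterMeasure (B s))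
    univ_nonempty
  refine ⟨s, le_trans ?_ hsum⟩
  calc (Fintype.card σ : ENNReal) * μ.toOuterMeasure (B s)
      = ∑ _s' : σ, μ.toOuterMeasure (B s) := by simp
    _ ≤ _ := Finset.sum_le_sum fun s' hs' => hs s' hs'

end Indistinguishability

/-! ### Monotonicity forces a discovery, and discoveries are rare -/

section Reduction

variable {N n : ℕ} (e : Fin N × Slot ↪ Fin n)

/-- The outputs at the input `input e l h ∅` that use the secret `s`. -/
def discoveries (X : Set ℝ) (l h : ℝ) (s : Finset (Fin N)) : Set (Alloc n) :=
  {x | x ∈ secretEnvironment e X s ∧ x ≠ unitAlloc (knownSet e) ∧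
    welfare (input e l h ∅) (unitAlloc (knownSet e)) ≤ welfare (input e l h ∅) x}

open Classical in
/-- A computation of time `t` discovers few secrets. -/
theorem card_filter_run_mem_discoveries_le {K : ℕ} (hN : N = 4 * K) {l h : ℝ} (hl : 0 < l)
    (hlh : l < h) {X : Set ℝ} (hX : ∀ a ∈ X, 0 ≤ a) (P : Program ({l, h} : Set ℝ) n) :
    (univ.filter fun s => P.run (secretEnvironment e X s) (secretRule e l h s) ∈
      discoveries e X l h s).card ≤
      P.time (knownEnvironment e X) (fun _ => unitAlloc (knownSet e)) * 2 ^ (N - K) := by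
  set x := P.run (knownEnvironment e X) (fun _ => unitAlloc (knownSet e))
  have hrun := Program.card_filter_run_ne_add_le (knownEnvironment e X)
    (fun _ => unitAlloc (knownSet e)) (secretEnvironment e X) (secretRule e l h) (2 ^ (N - K))
    (fun w => ?_) (fun y => ?_) P
  · refine le_trans ?_ hrun
    -- The spare summand `2 ^ (N - K)` in `hrun` pays for secrets for which the unchanged output `x`
    -- is a lucky guess.
    refine le_trans (card_le_card (t := _ ∪ univ.filter fun s =>
      x ∈ secretEnvironment e X s ∧ x ∉ knownEnvironment e X) fun s hs => ?_)
      ((card_union_le _ _).trans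
        (Nat.add_le_add_left (card_filter_mem_secretEnvironment_le e hN hX x) _))
    simp only [mem_union, mem_filter, mem_univ, true_and] at hs ⊢
    by_cases hr : P.run (secretEnvironment e X s) (secretRule e l h s) = x
    · rw [hr] at hs
      exact Or.inr ⟨hs.1, fun h' =>
        hs.2.1 (eq_knownSet_of_mem_knownEnvironment e hl hlh h' hs.2.2)⟩
    · exact Or.inl hr
  -- The inputs of different secrets differ, so `w` is the special input of at most one secret.
  · refine le_trans (Finset.card_le_one.mpr fun s hs t ht => ?_) Nat.one_le_two_pow
    have key : ∀ s, secretRule e l h s w ≠ unitAlloc (knownSet e) → w = input e l h s := by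
      intro s hs
      by_contra hne
      exact hs (by simp [secretRule, hne])
    exact input_injective e hlh
      ((key s (mem_filter.mp hs).2).symm.trans (key t (mem_filter.mp ht).2))
  · refine le_trans (card_le_card fun s hs => ?_)
      (card_filter_mem_secretEnvironment_le e hN hX y)
    simp only [mem_filter, mem_univ, true_and] at hs ⊢
    by_contra hne
    exact hs ⟨fun h1 => by_contra fun h2 => hne ⟨h1, h2⟩, fun h1 =>
      knownEnvironment_subset e X s h1⟩

/-- A monotone welfare-preserving rule must use the secret at `input e l h ∅`. -/
theorem mem_discoveries_of_monotoneRule (hN : 0 < N) {l h : ℝ} (hl : 0 < l) (hlh : l < h)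
    {X : Set ℝ} (hX : ∀ a ∈ X, 0 ≤ a) {s : Finset (Fin N)} {B : Rule ({l, h} : Set ℝ) n}
    (hB : IsAlgorithm (secretEnvironment e X s) B) (hmono : MonotoneRule B)
    (hw : PreservesWelfare (secretRule e l h s) B) :
    B (input e l h ∅) ∈ discoveries e X l h s := by
  have hw' : ∀ K, welfare (input e l h K) (unitAlloc (knownSet e)) ≤
      welfare (input e l h K) (B (input e l h K)) := fun K =>
    (welfare_knownSet_le_secretRule e hN (hl.trans hlh) s K).trans (hw _)
  refine ⟨hB _, fun h0 => ?_, hw' ∅⟩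
  -- Leaving the known allocation would drop the raised agent from 1 to 0.
  have hK : ∀ K ⊆ s, B (input e l h K) = unitAlloc (knownSet e) := by
    intro K
    induction K using Finset.induction_on with
    | empty => exact fun _ => h0
    | insert j K _ ih =>
      intro hKs
      by_contra hne
      have h1 := amount_eq_zero_of_ne_knownSet e hl hlh hX (hB _) (hw' _) hne
        (hKs (mem_insert_self j K))
      have h2 := hmono _ _ _ (raises_input e hlh (K := K) j)
      rw [h1, ih ((subset_insert j K).trans hKs), unitAlloc_knownSet_inl] at h2
      linarith
  have h1 := hw (input e l h s)
  rw [hK s Subset.rfl, secretRule, if_pos rfl] at h1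
  exact absurd h1 (not_le.mpr (welfare_knownSet_lt_secretSet e hN (hl.trans hlh) s))

end Reduction

/-! ### From single computations to randomized transformations -/

section Transformations

variable {l h : ℕ → ℝ} {X : Set ℝ} {N n : ℕ} (e : Fin N × Slot ↪ Fin n)
  (T : Transformation fun n => ({l n, h n} : Set ℝ))

/-- The seeds for which `T` uses the secret `s` at the input that does not reveal it. -/
def discoveringSeeds (X : Set ℝ) (s : Finset (Fin N)) : Set (T.Seed n) :=
  {ω | T.apply (secretEnvironment e X s) (secretRule e (l n) (h n) s) ω (input e (l n) (h n) ∅) ∈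
    discoveries e X (l n) (h n) s}

theorem exists_toOuterMeasure_discoveringSeeds_le {K : ℕ} (hN : N = 4 * K) (hl : 0 < l n)
    (hlh : l n < h n) (hX0 : 0 ∈ X) (hX1 : 1 ∈ X) (hX : ∀ a ∈ X, 0 ≤ a) {t : ℕ}
    (hT : ∀ (F : Set (Alloc n)) (A : Rule ({l n, h n} : Set ℝ) n), DownwardClosed X F →
      IsAlgorithm F A → ∀ ω ∈ (T.law n).support, ∀ v, (T.prog n ω v).time F A ≤ t) :
    ∃ s, (2 : ENNReal) ^ K * (T.law n).toOuterMeasure (discoveringSeeds e T X s) ≤ t := by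
  classical
  obtain ⟨s, hs⟩ := exists_card_mul_toOuterMeasure_le (T.law n)
    (fun s : Finset (Fin N) => discoveringSeeds e T X s) (t * 2 ^ (N - K)) fun ω hω => by
      refine le_trans (card_filter_run_mem_discoveries_le e hN hl hlh hX
        (T.prog n ω (input e (l n) (h n) ∅))) ?_
      exact Nat.mul_le_mul_right _ (hT _ _ (downwardClosed_environment _ _)
        (isAlgorithm_knownSet e hX0 hX1) ω hω _)
  refine ⟨s, ?_⟩
  have h2 : (2 : ENNReal) ^ (N - K) ≠ 0 := by simp
  have h3 : (2 : ENNReal) ^ (N - K) ≠ ⊤ := ENNReal.pow_ne_top (by simp)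
  rw [Fintype.card_finset, Fintype.card_fin] at hs
  push_cast at hs
  rw [show (2 : ENNReal) ^ N = 2 ^ (N - K) * 2 ^ K by rw [← pow_add]; congr 1; omega, mul_assoc,
    mul_comm (t : ENNReal)] at hs
  exact (ENNReal.mul_le_mul_iff_right h2 h3).mp hs

theorem successSeeds_subset_discoveringSeeds (hN : 0 < N) (hl : 0 < l n) (hlh : l n < h n)
    (hX : ∀ a ∈ X, 0 ≤ a) (s : Finset (Fin N)) :
    T.successSeeds (secretEnvironment e X s) (secretRule e (l n) (h n) s) ⊆
      discoveringSeeds e T X s := fun _ hω =>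
  mem_discoveries_of_monotoneRule e hN hl hlh hX hω.1 hω.2.1 hω.2.2

/-- A transformation that is monotone in expectation almost surely uses the secret at the input
that does not reveal it. -/
theorem support_subset_discoveringSeeds (hN : 0 < N) (hl : 0 < l n) (hlh : l n < h n)
    (hX0 : 0 ∈ X) (hX1 : 1 ∈ X) (hX : ∀ a ∈ X, 0 ≤ a) (hF : T.Feasible X) (hM : T.Monotone X)
    (hW : T.WelfarePreserving X) (s : Finset (Fin N)) :
    (T.law n).support ⊆ discoveringSeeds e T X s := by
  set F := secretEnvironment e X s
  set A := secretRule e (l n) (h n) s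
  have hdc : DownwardClosed X F := downwardClosed_environment _ _
  have hA : IsAlgorithm F A := isAlgorithm_secretRule e hX0 hX1 s
  have hB := fun ω hω => hF n F A hdc hA ω hω
  have hw := fun ω hω => hW n F A hdc hA ω hω
  have hw' : ∀ ω ∈ (T.law n).support, ∀ K,
      welfare (input e (l n) (h n) K) (unitAlloc (knownSet e)) ≤
        welfare (input e (l n) (h n) K) (T.apply F A ω (input e (l n) (h n) K)) := fun ω hω K =>
    (welfare_knownSet_le_secretRule e hN (hl.trans hlh) s K).trans (hw ω hω _)
  set q : Finset (Fin N) → ENNReal := fun K => (T.law n).toOuterMeasure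
    {ω | T.apply F A ω (input e (l n) (h n) K) = unitAlloc (knownSet e)} with hq
  -- Almost surely the amount is the indicator of the known output.
  have hamount : ∀ K, ∀ j ∈ s,
      T.expectedAmount F A (input e (l n) (h n) K) (e (j, .inl false)) = q K := by
    intro K j hj
    rw [hq, Transformation.expectedAmount]
    simp only [PMF.toOuterMeasure_apply]
    refine tsum_congr fun ω => ?_
    by_cases hω : T.law n ω = 0
    · simp [Set.indicator, hω]
    have hω' := (PMF.mem_support_iff _ _).mpr hω
    by_cases hr : T.apply F A ω (input e (l n) (h n) K) = unitAlloc (knownSet e)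
    · rw [Set.indicator_of_mem (by exact hr), hr, unitAlloc_knownSet_inl]
      simp
    · rw [Set.indicator_of_notMem (by exact hr),
        amount_eq_zero_of_ne_knownSet e hl hlh hX (hB ω hω' _) (hw' ω hω' K) hr hj]
      simp
  have hmono : ∀ K ⊆ s, q ∅ ≤ q K := by
    intro K
    induction K using Finset.induction_on with
    | empty => exact fun _ => le_rfl
    | insert j K _ ih =>
      intro hKs
      refine (ih ((subset_insert j K).trans hKs)).trans ?_
      have hj : j ∈ s := hKs (mem_insert_self j K)
      rw [← hamount K j hj, ← hamount (insert j K) j hj]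
      exact hM n F A hdc hA _ _ _ (raises_input e hlh j)
  have hs : q s = 0 := by
    rw [hq, PMF.toOuterMeasure_apply_eq_zero_iff, Set.disjoint_left]
    intro ω hω hr
    have h1 := hw ω hω (input e (l n) (h n) s)
    rw [Set.mem_ofPred_eq] at hr
    rw [hr] at h1
    simp only [A, secretRule, if_true] at h1
    exact absurd h1 (not_le.mpr (welfare_knownSet_lt_secretSet e hN (hl.trans hlh) s))
  have h0 : q ∅ = 0 := le_antisymm ((hmono s Subset.rfl).trans hs.le) bot_le
  rw [hq, PMF.toOuterMeasure_apply_eq_zero_iff, Set.disjoint_left] at h0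
  exact fun ω hω => ⟨hB ω hω _, h0 hω, hw' ω hω ∅⟩

end Transformations

/-! ### Polynomial against exponential growth -/

theorem tendsto_polynomial_div_pow (p : Polynomial ℕ) {r : ℝ} (hr : 1 < r) :
    Tendsto (fun n : ℕ => ((p.eval n : ℕ) : ℝ) / r ^ n) atTop (nhds 0) := by
  induction p using Polynomial.induction_on' with
  | add p q hp hq =>
    simpa [Polynomial.eval_add, add_div] using hp.add hq
  | monomial d a =>
    simpa [Polynomial.eval_monomial, mul_div_assoc] using
      (tendsto_pow_const_div_const_pow_of_one_lt d hr).const_mul (a : ℝ)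

theorem eventually_polynomial_lt_two_pow_div (p : Polynomial ℕ) {k : ℕ} (hk : 0 < k) :
    ∀ᶠ n : ℕ in atTop, p.eval n < 2 ^ (n / k) := by
  have hk' : (k : ℝ) ≠ 0 := by positivity
  set r : ℝ := 2 ^ (1 / k : ℝ)
  have hr : 1 < r := Real.one_lt_rpow one_lt_two (by positivity)
  have hrk : r ^ k = 2 := by
    rw [← Real.rpow_natCast, ← Real.rpow_mul two_pos.le, one_div_mul_cancel hk', Real.rpow_one]
  -- The bound `1 / 2` absorbs the factor 2 lost by rounding `n / k` down.
  filter_upwards [(tendsto_polynomial_div_pow p hr).eventually_lt_const (show (0 : ℝ) < 1 / 2 by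
    norm_num)] with n hn
  have hpos : 0 < r ^ n := by positivity
  rw [div_lt_iff₀ hpos] at hn
  have hle : r ^ n ≤ 2 ^ (n / k + 1) := by
    rw [← hrk, ← pow_mul]
    refine pow_le_pow_right₀ hr.le ?_
    have := Nat.div_add_mod n k
    have := Nat.mod_lt n hk
    rw [mul_add]
    omega
  have : ((p.eval n : ℕ) : ℝ) < 2 ^ (n / k) := by
    rw [pow_succ] at hle
    linarith
  exact_mod_cast this

end BlackBox

/-- No polynomial-time, monotone, welfare-preserving transformation exists for two values
`l < h` in downward-closed environments, even if it is randomized and adaptive, may query the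
feasibility set, and is monotone only in expectation. Moreover, the probability that the rule
computed by a polynomial-time transformation is monotone and welfare-preserving is smaller than
any inverse polynomial, for a suitable environment and algorithm. -/
theorem theorem1 (l h : ℕ → ℝ) (hl : ∀ n, 0 < l n) (hlh : ∀ n, l n < h n)
    (X : Set ℝ) (hX0 : 0 ∈ X) (hX1 : 1 ∈ X) (hX : ∀ a ∈ X, 0 ≤ a) :
    (¬ ∃ T : BlackBox.Transformation (fun n => ({l n, h n} : Set ℝ)),
      T.PolynomialTime X ∧ T.Feasible X ∧ T.Monotone X ∧ T.WelfarePreserving X) ∧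
    (∀ T : BlackBox.Transformation (fun n => ({l n, h n} : Set ℝ)), T.PolynomialTime X →
      ∀ c : ℕ, ∀ᶠ n : ℕ in Filter.atTop,
        ∃ (F : Set (BlackBox.Alloc n)) (A : BlackBox.Rule ({l n, h n} : Set ℝ) n),
          BlackBox.DownwardClosed X F ∧ BlackBox.IsAlgorithm F A ∧
          (T.law n).toOuterMeasure (T.successSeeds F A) ≤ ((n : ENNReal) ^ c)⁻¹) := by
  -- With `K = n / 32` there are `4 * K` blocks of 8 agents, hence `32 * K ≤ n` agents in use.
  have embed : ∀ n : ℕ, Nonempty (Fin (4 * (n / 32)) × BlackBox.Slot ↪ Fin n) := fun n =>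
    Function.Embedding.nonempty_of_card_le (by
      simp only [Fintype.card_prod, Fintype.card_sum, Fintype.card_fin, Fintype.card_bool]
      omega)
  constructor
  · rintro ⟨T, ⟨p, hp⟩, hF, hM, hW⟩
    obtain ⟨n, hn, hn32⟩ := ((BlackBox.eventually_polynomial_lt_two_pow_div p
      (show 0 < 32 by norm_num)).and (Filter.eventually_ge_atTop 32)).exists
    obtain ⟨e⟩ := embed n
    obtain ⟨s, hs⟩ := BlackBox.exists_toOuterMeasure_discoveringSeeds_le e T rfl (hl n) (hlh n)
      hX0 hX1 hX (hp n)
    rw [(PMF.toOuterMeasure_apply_eq_one_iff _ _).mpr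
      (BlackBox.support_subset_discoveringSeeds e T (by omega) (hl n) (hlh n) hX0 hX1 hX hF hM hW
        s), mul_one] at hs
    exact absurd (by exact_mod_cast hs) (not_le.mpr hn)
  · rintro T ⟨p, hp⟩ c
    -- The factor `X ^ c` turns the bound `p n / 2 ^ (n / 32)` on the success probability into `n ^
    -- (-c)`.
    filter_upwards [BlackBox.eventually_polynomial_lt_two_pow_div (p * Polynomial.X ^ c)
      (show 0 < 32 by norm_num), Filter.eventually_ge_atTop 32] with n hn hn32
    obtain ⟨e⟩ := embed n
    obtain ⟨s, hs⟩ := BlackBox.exists_toOuterMeasure_discoveringSeeds_le e T rfl (hl n) (hlh n)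
      hX0 hX1 hX (hp n)
    refine ⟨BlackBox.secretEnvironment e X s, BlackBox.secretRule e (l n) (h n) s,
      BlackBox.downwardClosed_environment _ _, BlackBox.isAlgorithm_secretRule e hX0 hX1 s,
      ((T.law n).toOuterMeasure.mono (BlackBox.successSeeds_subset_discoveringSeeds e T (by omega)
        (hl n) (hlh n) hX s)).trans ?_⟩
    rw [ENNReal.le_inv_iff_mul_le]
    have h2 : (2 : ENNReal) ^ (n / 32) ≠ 0 := by simp
    have h3 : (2 : ENNReal) ^ (n / 32) ≠ ⊤ := ENNReal.pow_ne_top (by simp)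
    refine (ENNReal.mul_le_mul_iff_right h2 h3).mp ?_
    rw [← mul_assoc, mul_one]
    refine (mul_le_mul_left hs _).trans ?_
    simp only [Polynomial.eval_mul, Polynomial.eval_pow, Polynomial.eval_X] at hn
    exact_mod_cast hn.le
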